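/- Let $S$ be a finite set of $n$ states which are the vertices of a connected undirected graph (no loops, no multiple edges). A real number $V_i$ is attached to each state $i$ and a real number $V_{ij}=V_{ji}$ to each edge $(i,j)$. Assume that all the numbers $V_i$ ($i\in S$) and $V_{ij}$ ($(i,j)$ an edge) are different, and that all the differences $V_{ij}-V_k$ ($(i,j)$ an edge, $k\in S$) are different. For $W\subseteq S$, a $W$-graph is a directed graph on $S$ whose arrows go along edges and start outside $W$, such that each state of $S\setminus W$ is the origin of exactly one arrow and there are no directed cycles; the states of $W$ are its sinks. Let $G(k)$ be the set of all $W$-graphs with $|W|=k$ and $$V^{(k)}=\min_{g\in G(k)}\ \sum_{(i\to j)\in g}(V_{ij}-V_i),\qquad k=1,\dots,n.$$ A $W$-graph $g\in G(k)$ is optimal if it attains this minimum. Then: 1. For each $k=1,\dots,n$ the minimum is attained at exactly one $W$-graph $g_k^*$. Let $W_k^*$ be its set of sinks and $\mathcal T_k^*$ the forest obtained from $g_k^*$ by forgetting the directions of the arrows. 2. The optimal $W$-graphs are nested: for $k=1,\dots,n-1$, $$W_k^*\subsetneq W_{k+1}^*,\qquad \mathcal T_k^*\supsetneq\mathcal T_{k+1}^*.$$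 3. The spanning tree $\mathcal T^*$ that minimizes the sum of $V_{ij}$ over its edges is unique, and $$V^{(1)}=\sum_{(i,j)\in\mathcal T^*}V_{ij}+\min_{i\in S}V_i-\sum_{i\in S}V_i.$$ 4. For $k=1,\dots,n-1$, $$V^{(k+1)}=V^{(k)}-\max\,(V_{pq}-V_i),$$ where the maximum is over all trees $t$ of the forest $\mathcal T_k^*$, all edges $(p,q)$ of $t$, and all states $i$ in $t''$; here $t''$ is that one of the two pieces into which the removal of $(p,q)$ splits $t$ which contains no state of $W_k^*$. The maximum is attained at exactly one edge $(p_k^*,q_k^*)$ and state $s_{k+1}^*$, the forest $\mathcal T_{k+1}^*$ is $\mathcal T_k^*$ without the edge $(p_k^*,q_k^*)$, $W_{k+1}^*=W_k^*\cup\{s_{k+1}^*\}$ with $s_{k+1}^*\notin W_k^*$, and $$\Delta_k:=V^{(k)}-V^{(k+1)}=V_{p_k^*q_k^*}-V_{s_{k+1}^*}.$$ -/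

import Mathlib

/-- A finite irreducible network with detailed balance: a connected graph of states, the potential
`V i` at every state and the potential `saddle s(i, j)` at every edge.  Working with unordered
pairs expresses `V_{ij} = V_{ji}`.  The values of `saddle` at pairs which are not edges are never
used. -/
structure PotentialNetwork (S : Type*) where
  graph : SimpleGraph S
  connected : graph.Connected
  V : S → ℝ
  saddle : Sym2 S → ℝ

namespace PotentialNetwork

variable {S : Type*}

/-- The genericness assumption: the potentials at the states and at the edges are pairwise
different, and the differences `V_{ij} - V_k` (edge `(i, j)`, state `k`) are pairwise different. -/
def Generic (N : PotentialNetwork S) : Prop :=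
  (∀ i j : S, N.V i = N.V j → i = j) ∧
  (∀ e ∈ N.graph.edgeSet, ∀ e' ∈ N.graph.edgeSet, N.saddle e = N.saddle e' → e = e') ∧
  (∀ e ∈ N.graph.edgeSet, ∀ i : S, N.saddle e ≠ N.V i) ∧
  (∀ e ∈ N.graph.edgeSet, ∀ e' ∈ N.graph.edgeSet, ∀ i j : S,
    N.saddle e - N.V i = N.saddle e' - N.V j → e = e' ∧ i = j)

/-- The set of arrows `g` (where `(i, j)` stands for `i → j`) is a `W`-graph: arrows go along
edges of the network and start outside `W`, each state outside `W` is the origin of exactly one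
arrow, and there is no directed cycle. -/
def IsWGraph (N : PotentialNetwork S) (W : Finset S) (g : Finset (S × S)) : Prop :=
  (∀ i j : S, (i, j) ∈ g → N.graph.Adj i j ∧ i ∉ W) ∧
  (∀ i : S, i ∉ W → ∃! j : S, (i, j) ∈ g) ∧
  (∀ i : S, ¬ Relation.TransGen (fun a b : S => (a, b) ∈ g) i i)

/-- The sum of `V_{ij} - V_i` over the arrows `i → j` of `g`. -/
def cost (N : PotentialNetwork S) (g : Finset (S × S)) : ℝ :=
  ∑ a ∈ g, (N.saddle s(a.1, a.2) - N.V a.1)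

/-- The costs of all `W`-graphs with `k` sinks. -/
def costs (N : PotentialNetwork S) (k : ℕ) : Set ℝ :=
  {c | ∃ (W : Finset S) (g : Finset (S × S)), W.card = k ∧ N.IsWGraph W g ∧ N.cost g = c}

/-- The number `V^{(k)}`, the minimal cost of a `W`-graph with `k` sinks. -/
noncomputable def Vmin (N : PotentialNetwork S) (k : ℕ) : ℝ :=
  sInf (N.costs k)

/-- `Δ_k = V^{(k)} - V^{(k+1)}`. -/
noncomputable def Delta (N : PotentialNetwork S) (k : ℕ) : ℝ :=
  N.Vmin k - N.Vmin (k + 1)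

/-- `g` is an optimal `W`-graph with `k` sinks, and `W` is its set of sinks. -/
def IsOptimal (N : PotentialNetwork S) (k : ℕ) (W : Finset S) (g : Finset (S × S)) : Prop :=
  W.card = k ∧ N.IsWGraph W g ∧
  ∀ (W' : Finset S) (g' : Finset (S × S)),
    W'.card = k → N.IsWGraph W' g' → N.cost g ≤ N.cost g'

/-- The undirected graph on `S` obtained from a directed graph by forgetting the directions of
its arrows. -/
def forest (g : Finset (S × S)) : SimpleGraph S :=
  SimpleGraph.fromRel (fun i j => (i, j) ∈ g)

open Classical in
/-- The sum of the potentials `V_{ij}` over the edges of `T`. -/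
noncomputable def edgeSum [Fintype S] (N : PotentialNetwork S) (T : SimpleGraph S) : ℝ :=
  ∑ e ∈ T.edgeFinset, N.saddle e

/-- `T` is a minimum spanning tree of the network for the edge costs `V_{ij}`. -/
def IsMinSpanningTree [Fintype S] (N : PotentialNetwork S) (T : SimpleGraph S) : Prop :=
  T ≤ N.graph ∧ T.IsTree ∧
  ∀ T' : SimpleGraph S, T' ≤ N.graph → T'.IsTree → N.edgeSum T ≤ N.edgeSum T'

/-- Pairs `(e, i)` over which the maximum in the recurrence runs: `e` is an edge of the forest
`T`, and `i` is a state of the tree `t` of `T` containing `e` that lies in the piece `t''` of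
`t` without `e` which contains no state of `W`. -/
def splits (W : Finset S) (T : SimpleGraph S) : Set (Sym2 S × S) :=
  {x | x.1 ∈ T.edgeSet ∧ (∀ p ∈ x.1, T.Reachable p x.2) ∧
    ∀ s ∈ W, ¬ (T.deleteEdges {x.1}).Reachable s x.2}

/-- The difference `V_{pq} - V_i` for an edge `(p, q)` and a state `i`. -/
def gain (N : PotentialNetwork S) (x : Sym2 S × S) : ℝ :=
  N.saddle x.1 - N.V x.2

end PotentialNetwork

/-! ### Coloured symmetric exchange families -/

namespace Exchange

/-! Join a new apex to every state. A `W`-graph becomes a spanning tree of this cone: forget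
directions and join each sink to the apex. Conversely, directing a spanning tree towards the apex
recovers the arrows. With weight `V_{ij}` on network edges (black) and `V_i` on apex edges (red),
the cost is the weight of the tree minus the constant `∑ V_i`, and the number of sinks is the number
of red edges. So the question is about minimum-weight spanning trees with `k` red edges.

Symmetric exchange of tree edges answers it. Let `B`, `C` be optimal at two levels. A red `y ∈ C \
B` has an exchange partner `x ∈ B \ C`. If `x` were red, both swaps would keep the levels, so `x`
and `y` would have equal weight, against genericness; hence `x` is black (`exists_black_swap`). For
levels `k` and `k + 2`, two choices of `y` give strict convexity of the minimal weight
(`strict_convex`), and convexity gives uniqueness (`isOpt_unique`). For levels `k` and `k + 1`, the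
swap trades levels at unchanged total weight, so both results are optimal and uniqueness gives `C =
B - x + y` (`isOpt_succ`).

Thus one edge is exchanged for one sink. By `mem_splits_iff` the admissible exchanges are exactly
the pairs in the recurrence, so the best one attains its maximum. -/

theorem sum_swap {α M : Type*} [DecidableEq α] [AddCommMonoid M] {B : Finset α} {x y : α}
    (hx : x ∈ B) (hy : y ∉ B) (f : α → M) :
    ∑ a ∈ insert y (B.erase x), f a + f x = ∑ a ∈ B, f a + f y := by
  rw [Finset.sum_insert (fun h => hy (Finset.mem_of_mem_erase h)), ← Finset.add_sum_erase B f hx]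
  ac_rfl

variable {α : Type*} [DecidableEq α]

/-- A family of finite sets with the symmetric exchange property. -/
def IsSymmExchange (𝓑 : Set (Finset α)) : Prop :=
  ∀ B ∈ 𝓑, ∀ C ∈ 𝓑, ∀ x ∈ B, x ∉ C → ∃ y ∈ C, y ∉ B ∧
    insert y (B.erase x) ∈ 𝓑 ∧ insert x (C.erase y) ∈ 𝓑

/-- The number of red elements. -/
def level (red : α → Prop) [DecidablePred red] (B : Finset α) : ℕ := (B.filter red).card

/-- `B` has minimal weight among the members of `𝓑` with `k` red elements. -/
def IsOpt (𝓑 : Set (Finset α)) (red : α → Prop) [DecidablePred red] (w : α → ℝ) (k : ℕ)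
    (B : Finset α) : Prop :=
  B ∈ 𝓑 ∧ level red B = k ∧ ∀ C ∈ 𝓑, level red C = k → ∑ a ∈ B, w a ≤ ∑ a ∈ C, w a

/-- Elements of members of `𝓑` of the same colour have different weights, and so do pairs of
elements of different colours. -/
def IsGenericWeight (𝓑 : Set (Finset α)) (red : α → Prop) (w : α → ℝ) : Prop :=
  (∀ B ∈ 𝓑, ∀ C ∈ 𝓑, ∀ x ∈ B, ∀ y ∈ C, (red x ↔ red y) → w x = w y → x = y) ∧
  (∀ B ∈ 𝓑, ∀ C ∈ 𝓑, ∀ x ∈ B, ∀ x' ∈ B, ∀ y ∈ C, ∀ y' ∈ C, ¬ red x → ¬ red x' → red y → red y' →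
    w x - w y = w x' - w y' → x = x' ∧ y = y')

variable {𝓑 : Set (Finset α)} {red : α → Prop} [DecidablePred red] {w : α → ℝ} {k : ℕ}
  {B C : Finset α}

theorem level_swap {x y : α} (hx : x ∈ B) (hy : y ∉ B) :
    level red (insert y (B.erase x)) + (if red x then 1 else 0) =
      level red B + (if red y then 1 else 0) := by
  simp only [level, Finset.card_filter]
  exact sum_swap hx hy _

omit [DecidableEq α] in
theorem exists_isOpt [Fintype α] (hB : B ∈ 𝓑) (hk : level red B = k) :
    ∃ C, IsOpt 𝓑 red w k C := by
  classical
  obtain ⟨C, hC, hmin⟩ := Finset.exists_min_image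
    (Finset.univ.filter fun D => D ∈ 𝓑 ∧ level red D = k) (fun D => ∑ a ∈ D, w a)
    ⟨B, by simp [hB, hk]⟩
  simp only [Finset.mem_filter, Finset.mem_univ, true_and] at hC hmin
  exact ⟨C, hC.1, hC.2, fun D hD hl => hmin D ⟨hD, hl⟩⟩

omit [DecidableEq α] in
theorem exists_red (h : level red B < level red C) : ∃ y ∈ C, y ∉ B ∧ red y := by
  obtain ⟨y, hy, hy'⟩ := Finset.exists_mem_notMem_of_card_lt_card h
  rw [Finset.mem_filter] at hy hy'
  exact ⟨y, hy.1, fun hB => hy' ⟨hB, hy.2⟩, hy.2⟩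

/-- A red element of an optimal set of a higher level is exchanged against a black one. -/
theorem exists_black_swap (hex : IsSymmExchange 𝓑) (hw : IsGenericWeight 𝓑 red w) {k l : ℕ}
    (hB : IsOpt 𝓑 red w k B) (hC : IsOpt 𝓑 red w l C) {y : α} (hyC : y ∈ C) (hyB : y ∉ B)
    (hy : red y) :
    ∃ x ∈ B, x ∉ C ∧ ¬ red x ∧ insert y (B.erase x) ∈ 𝓑 ∧ insert x (C.erase y) ∈ 𝓑 := by
  obtain ⟨x, hxB, hxC, h1, h2⟩ := hex C hC.1 B hB.1 y hyC hyB
  refine ⟨x, hxB, hxC, fun hx => ?_, h2, h1⟩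
  have l1 := level_swap (red := red) hxB hyB
  have l2 := level_swap (red := red) hyC hxC
  simp only [hx, hy, if_true, add_left_inj] at l1 l2
  have e1 := hB.2.2 _ h2 (l1.trans hB.2.1)
  have e2 := hC.2.2 _ h1 (l2.trans hC.2.1)
  have s1 := sum_swap hxB hyB w
  have s2 := sum_swap hyC hxC w
  have := hw.1 B hB.1 C hC.1 x hxB y hyC (by simp [hx, hy]) (by linarith)
  exact hyB (this ▸ hxB)

/-- Strict convexity of the minimal weight as a function of the level. -/
theorem strict_convex (hex : IsSymmExchange 𝓑) (hw : IsGenericWeight 𝓑 red w) {D : Finset α}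
    (hB : IsOpt 𝓑 red w k B) (hC : IsOpt 𝓑 red w (k + 2) C) (hD : IsOpt 𝓑 red w (k + 1) D) :
    2 * ∑ a ∈ D, w a < ∑ a ∈ B, w a + ∑ a ∈ C, w a := by
  have key : ∀ y ∈ C, y ∉ B → red y → ∃ x ∈ B, x ∉ C ∧ ¬ red x ∧
      ∑ a ∈ D, w a ≤ ∑ a ∈ B, w a + w y - w x ∧ ∑ a ∈ D, w a ≤ ∑ a ∈ C, w a + w x - w y := by
    intro y hyC hyB hy
    obtain ⟨x, hxB, hxC, hx, h1, h2⟩ := exists_black_swap hex hw hB hC hyC hyB hy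
    have l1 := level_swap (red := red) hxB hyB
    have l2 := level_swap (red := red) hyC hxC
    simp only [hx, hy, if_true, if_false, hB.2.1, hC.2.1] at l1 l2
    have e1 := hD.2.2 _ h1 (by omega)
    have e2 := hD.2.2 _ h2 (by omega)
    have s1 := sum_swap hxB hyB w
    have s2 := sum_swap hyC hxC w
    exact ⟨x, hxB, hxC, hx, by linarith, by linarith⟩
  -- The level gap of two leaves at least two red elements in `C \ B`. If convexity were not strict,
  -- both would have a partner with the same difference `w x - w y`.
  have hcard : 1 < (C.filter red \ B.filter red).card := by
    have h1 := Finset.le_card_sdiff (B.filter red) (C.filter red)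
    have h2 : (B.filter red).card = k := hB.2.1
    have h3 : (C.filter red).card = k + 2 := hC.2.1
    omega
  obtain ⟨y, hy, y', hy', hne⟩ := Finset.one_lt_card.1 hcard
  simp only [Finset.mem_sdiff, Finset.mem_filter, not_and] at hy hy'
  obtain ⟨x, hxB, -, hx, e1, e2⟩ := key y hy.1.1 (fun h => hy.2 h hy.1.2) hy.1.2
  obtain ⟨x', hxB', -, hx', e1', e2'⟩ := key y' hy'.1.1 (fun h => hy'.2 h hy'.1.2) hy'.1.2
  by_contra hlt
  exact hne (hw.2 B hB.1 C hC.1 x hxB x' hxB' y hy.1.1 y' hy'.1.1 hx hx' hy.1.2 hy'.1.2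
    (by linarith)).2

/-- Exchange between two optimal sets of one level. Partners of equal colour would have equal
weights. Partners of different colours give sets one level below and one above with total weight
twice the optimum, against strict convexity. -/
theorem isOpt_unique [Fintype α] (hex : IsSymmExchange 𝓑) (hw : IsGenericWeight 𝓑 red w)
    (hcard : ∀ B ∈ 𝓑, ∀ C ∈ 𝓑, B.card = C.card)
    (hB : IsOpt 𝓑 red w k B) (hC : IsOpt 𝓑 red w k C) : B = C := by
  by_contra hne
  have hsub : ¬ B ⊆ C := fun h => hne (Finset.eq_of_subset_of_card_le h
    (hcard B hB.1 C hC.1).ge)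
  obtain ⟨x, hxB, hxC⟩ := Finset.not_subset.1 hsub
  obtain ⟨y, hyC, hyB, h1, h2⟩ := hex B hB.1 C hC.1 x hxB hxC
  have l1 := level_swap (red := red) hxB hyB
  have l2 := level_swap (red := red) hyC hxC
  have s1 := sum_swap hxB hyB w
  have s2 := sum_swap hyC hxC w
  have heq : ∑ a ∈ B, w a = ∑ a ∈ C, w a :=
    le_antisymm (hB.2.2 _ hC.1 hC.2.1) (hC.2.2 _ hB.1 hB.2.1)
  rw [hB.2.1] at l1
  rw [hC.2.1] at l2
  have main : ∀ (m : ℕ) (D E : Finset α), D ∈ 𝓑 → E ∈ 𝓑 → level red D = m →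
      level red E = m + 2 → m + 1 = k →
      ∑ a ∈ D, w a + ∑ a ∈ E, w a = ∑ a ∈ B, w a + ∑ a ∈ C, w a → False := by
    rintro m D E hD hE hDl hEl rfl hsum
    obtain ⟨D', hD'⟩ := exists_isOpt (w := w) hD hDl
    obtain ⟨E', hE'⟩ := exists_isOpt (w := w) hE hEl
    have := strict_convex hex hw hD' hE' hB
    have := hD'.2.2 D hD hDl
    have := hE'.2.2 E hE hEl
    linarith
  by_cases hx : red x <;> by_cases hy : red y <;>
    simp only [hx, hy, if_true, if_false, add_left_inj, add_zero] at l1 l2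
  · have e1 := hB.2.2 _ h1 l1
    have e2 := hC.2.2 _ h2 l2
    exact hyB (hw.1 B hB.1 C hC.1 x hxB y hyC (by simp [hx, hy]) (by linarith) ▸ hxB)
  · exact main _ _ _ h1 h2 rfl (by omega) l1 (by linarith)
  · exact main _ _ _ h2 h1 rfl (by omega) l2 (by linarith)
  · have e1 := hB.2.2 _ h1 l1
    have e2 := hC.2.2 _ h2 l2
    exact hyB (hw.1 B hB.1 C hC.1 x hxB y hyC (by simp [hx, hy]) (by linarith) ▸ hxB)

/-- Optimal sets of consecutive levels differ by one exchange. -/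
theorem isOpt_succ [Fintype α] (hex : IsSymmExchange 𝓑) (hw : IsGenericWeight 𝓑 red w)
    (hcard : ∀ B ∈ 𝓑, ∀ C ∈ 𝓑, B.card = C.card)
    (hB : IsOpt 𝓑 red w k B) (hC : IsOpt 𝓑 red w (k + 1) C) :
    ∃ x ∈ B, ∃ y ∉ B, ¬ red x ∧ red y ∧ C = insert y (B.erase x) := by
  obtain ⟨y, hyC, hyB, hy⟩ := exists_red (red := red) (B := B) (C := C)
    (by rw [hB.2.1, hC.2.1]; omega)
  obtain ⟨x, hxB, hxC, hx, h1, h2⟩ := exists_black_swap hex hw hB hC hyC hyB hy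
  refine ⟨x, hxB, y, hyB, hx, hy, ?_⟩
  have l1 := level_swap (red := red) hxB hyB
  have l2 := level_swap (red := red) hyC hxC
  simp only [hx, hy, if_true, if_false, hB.2.1, hC.2.1, add_zero] at l1 l2
  -- The reverse swap puts `C` at level `k`, where `B` is optimal. This yields `w y ≤ w(C) - w(B) +
  -- w x`, so the swapped `B` is no heavier than `C`.
  have e2 := hB.2.2 _ h2 (by omega)
  have s1 := sum_swap hxB hyB w
  have s2 := sum_swap hyC hxC w
  refine isOpt_unique hex hw hcard hC ⟨h1, l1, fun D hD hl => ?_⟩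
  have := hC.2.2 D hD hl
  linarith

end Exchange

/-! ### Exchange of edges between spanning trees -/

namespace SimpleGraph

variable {V : Type*}

/-- An acyclic graph extends to a spanning tree, and the edge count leaves no room for a further
edge. -/
theorem IsAcyclic.isTree_of_card [Finite V] [Nonempty V] {G : SimpleGraph V} (h : G.IsAcyclic)
    (hcard : Nat.card G.edgeSet + 1 = Nat.card V) : G.IsTree := by
  obtain ⟨F, hGF, -, hF⟩ := (connected_top (V := V)).exists_isTree_le_of_le_of_isAcyclic le_top h
  have h2 := (isTree_iff_connected_and_card.1 hF).2
  have : G.edgeSet = F.edgeSet :=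
    Set.eq_of_subset_of_ncard_le (edgeSet_mono hGF) (by
      rw [← Nat.card_coe_set_eq, ← Nat.card_coe_set_eq]; omega) (Set.toFinite _)
  rwa [edgeSet_inj.1 this]

/-- Deleting `x = ab` from `T` separates `a` from `b`, so the `T'`-path from `a` to `b` has an edge
`y` leaving the component of `a`. It reconnects `T - x`. As `y` lies on the unique `T'`-path, `a`
and `b` are separated in `T' - y`. -/
theorem IsTree.exists_exchange {T T' : SimpleGraph V} (hT : T.IsTree) (hT' : T'.IsTree)
    {x : Sym2 V} (hx : x ∈ T.edgeSet) (hx' : x ∉ T'.edgeSet) :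
    ∃ y ∈ T'.edgeSet, y ∉ T.edgeSet ∧ (T.deleteEdges {x} ⊔ fromEdgeSet {y}).IsAcyclic ∧
      (T'.deleteEdges {y} ⊔ fromEdgeSet {x}).IsAcyclic := by
  classical
  induction x with | _ a b =>
  have hbr : ¬ (T.deleteEdges {s(a, b)}).Reachable a b :=
    isBridge_iff.1 (isAcyclic_iff_forall_isBridge.1 hT.isAcyclic hx)
  obtain ⟨p, hp⟩ := hT'.connected.exists_isPath a b
  obtain ⟨d, hd, hu, hv⟩ := p.exists_boundary_dart
    {v | (T.deleteEdges {s(a, b)}).Reachable a v} (Reachable.refl _) hbr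
  obtain ⟨⟨u, v⟩, huv⟩ := d
  simp only [Set.mem_ofPred_eq] at hu hv huv
  have hne : s(u, v) ≠ s(a, b) := fun h => hx' (h ▸ huv)
  refine ⟨s(u, v), huv, fun h => hv (hu.trans (Adj.reachable ?_)), ?_, ?_⟩
  · rw [deleteEdges_adj]
    exact ⟨h, hne⟩
  · exact (hT.isAcyclic.anti (deleteEdges_le _)).sup_edge_of_not_reachable
      fun h => hv (hu.trans h)
  · refine (hT'.isAcyclic.anti (deleteEdges_le _)).sup_edge_of_not_reachable fun h => ?_
    obtain ⟨q, hq⟩ := reachable_deleteEdges_iff_exists_walk.1 h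
    have h1 := (hT'.isAcyclic.subsingleton_path a b).elim ⟨p, hp⟩ q.toPath
    have h2 : s(u, v) ∈ p.edges := List.mem_map.2 ⟨_, hd, rfl⟩
    have h3 : p = (q.toPath : T'.Walk a b) := congrArg Subtype.val h1
    rw [h3] at h2
    exact hq (q.edges_toPath_subset_edges h2)

end SimpleGraph

/-! ### Spanning trees of the cone over a network -/

namespace PotentialNetwork

variable {S : Type*}

/-- The edge of the cone given by an edge of the network or by a sink. -/
def coneEdge : Sym2 S ⊕ S → Sym2 (Option S) :=
  Sum.elim (Sym2.map some) (fun i => s(none, some i))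

theorem coneEdge_injective : Function.Injective (coneEdge (S := S)) := by
  rintro (e | i) (f | j) h
  · exact congrArg _ (Sym2.map.injective (Option.some_injective S) h)
  · induction e with | _ a b => simp [coneEdge] at h
  · induction f with | _ a b => simp [coneEdge] at h
  · simpa [coneEdge] using h

/-- The graph on `S` and one further vertex `none` with the edges and sinks listed by `B`. -/
def cone (B : Finset (Sym2 S ⊕ S)) : SimpleGraph (Option S) :=
  SimpleGraph.fromEdgeSet (coneEdge '' (B : Set (Sym2 S ⊕ S)))

/-- The graph on `S` formed by the edges listed by `B`. -/
def forestPart (B : Finset (Sym2 S ⊕ S)) : SimpleGraph S :=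
  SimpleGraph.fromEdgeSet (B.toLeft : Set (Sym2 S))

/-- Spanning trees of the cone over the network. -/
def bases [Fintype S] (N : PotentialNetwork S) : Set (Finset (Sym2 S ⊕ S)) :=
  {B | (∀ e, Sum.inl e ∈ B → e ∈ N.graph.edgeSet) ∧ (cone B).IsAcyclic ∧ B.card = Fintype.card S}

variable {N : PotentialNetwork S} {B : Finset (Sym2 S ⊕ S)} {i j : S}

theorem forestPart_adj : (forestPart B).Adj i j ↔ Sum.inl s(i, j) ∈ B ∧ i ≠ j := by
  simp [forestPart]

theorem cone_adj_some : (cone B).Adj (some i) (some j) ↔ (forestPart B).Adj i j := by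
  rw [forestPart_adj]
  have : coneEdge (Sum.inl s(i, j)) = s(some i, some j) := rfl
  rw [cone, SimpleGraph.fromEdgeSet_adj, ← this, coneEdge_injective.mem_set_image]
  simp

theorem cone_adj_none : (cone B).Adj none (some i) ↔ Sum.inr i ∈ B := by
  have : coneEdge (Sum.inr i) = s(none, some i) := rfl
  rw [cone, SimpleGraph.fromEdgeSet_adj, ← this, coneEdge_injective.mem_set_image]
  simp

theorem edgeSet_cone (h : ∀ e, Sum.inl e ∈ B → ¬ e.IsDiag) :
    (cone B).edgeSet = coneEdge '' (B : Set (Sym2 S ⊕ S)) := by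
  rw [cone, SimpleGraph.edgeSet_fromEdgeSet, sdiff_eq_left, Set.disjoint_left]
  rintro _ ⟨e | i, he, rfl⟩ hd
  · refine h e he ?_
    induction e with | _ a b => simpa [coneEdge] using hd
  · simp [coneEdge] at hd

theorem card_edgeSet_cone (h : ∀ e, Sum.inl e ∈ B → ¬ e.IsDiag) :
    Nat.card (cone B).edgeSet = B.card := by
  rw [edgeSet_cone h, Nat.card_image_of_injective coneEdge_injective]
  simp

theorem forestPart_reachable_cone (h : (forestPart B).Reachable i j) :
    (cone B).Reachable (some i) (some j) :=
  h.map ⟨some, fun h => cone_adj_some.2 h⟩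

/-- After its last visit to the apex, a walk enters the states at a sink and stays in the forest. -/
theorem cone_reachable_none_iff :
    (cone B).Reachable none (some j) ↔ ∃ s, Sum.inr s ∈ B ∧ (forestPart B).Reachable s j := by
  constructor
  · intro h
    have key : ∀ v, (cone B).Reachable none v → ∀ j, v = some j →
        ∃ s, Sum.inr s ∈ B ∧ (forestPart B).Reachable s j := by
      intro v hv
      rw [SimpleGraph.reachable_iff_reflTransGen] at hv
      induction hv with
      | refl => simp
      | @tail b c _ hbc ih =>
        rintro j rfl
        cases b with
        | none => exact ⟨j, cone_adj_none.1 hbc, .refl _⟩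
        | some b =>
          obtain ⟨s, hs, hr⟩ := ih b rfl
          exact ⟨s, hs, hr.trans (cone_adj_some.1 hbc).reachable⟩
    exact key _ h _ rfl
  · rintro ⟨s, hs, hr⟩
    exact (cone_adj_none.2 hs).reachable.trans (forestPart_reachable_cone hr)

theorem not_isDiag_of_mem_bases (hB : ∀ e, Sum.inl e ∈ B → e ∈ N.graph.edgeSet) (e : Sym2 S)
    (he : Sum.inl e ∈ B) : ¬ e.IsDiag :=
  N.graph.not_isDiag_of_mem_edgeSet (hB e he)

variable [Fintype S]

theorem isTree_cone (hB : B ∈ N.bases) : (cone B).IsTree := by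
  refine hB.2.1.isTree_of_card ?_
  rw [card_edgeSet_cone (not_isDiag_of_mem_bases hB.1), hB.2.2]
  simp

/-- The cone is connected with one edge fewer than vertices, so it is a tree. -/
theorem mem_bases_of_reachable (hB : ∀ e, Sum.inl e ∈ B → e ∈ N.graph.edgeSet)
    (hcard : B.card = Fintype.card S)
    (hr : ∀ j, ∃ s, Sum.inr s ∈ B ∧ (forestPart B).Reachable s j) : B ∈ N.bases := by
  refine ⟨hB, ?_, hcard⟩
  have hn : ∀ v, (cone B).Reachable none v := by
    rintro (_ | j)
    · exact .refl _
    · exact cone_reachable_none_iff.2 (hr j)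
  have hc : (cone B).Connected := ⟨fun u v => (hn u).symm.trans (hn v)⟩
  refine (SimpleGraph.isTree_iff_connected_and_card.2 ⟨hc, ?_⟩).isAcyclic
  rw [card_edgeSet_cone (not_isDiag_of_mem_bases hB), hcard]
  simp

theorem exists_reachable_sink (hB : B ∈ N.bases) (j : S) :
    ∃ s, Sum.inr s ∈ B ∧ (forestPart B).Reachable s j :=
  cone_reachable_none_iff.1 ((isTree_cone hB).connected none (some j))

variable [DecidableEq S]

omit [Fintype S] in
theorem cone_erase (x : Sym2 S ⊕ S) : cone (B.erase x) = (cone B).deleteEdges {coneEdge x} := by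
  rw [cone, cone, SimpleGraph.deleteEdges_fromEdgeSet, Finset.coe_erase,
    Set.image_sdiff coneEdge_injective, Set.image_singleton]

omit [Fintype S] in
theorem cone_insert (y : Sym2 S ⊕ S) :
    cone (insert y B) = cone B ⊔ SimpleGraph.fromEdgeSet {coneEdge y} := by
  rw [cone, cone, ← SimpleGraph.fromEdgeSet_union, Finset.coe_insert, Set.image_insert_eq,
    Set.union_singleton]

omit [Fintype S] in
theorem forestPart_erase_inl (e : Sym2 S) :
    forestPart (B.erase (Sum.inl e)) = (forestPart B).deleteEdges {e} := by
  rw [forestPart, forestPart, SimpleGraph.deleteEdges_fromEdgeSet]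
  congr 1
  ext f
  simp [and_comm]

theorem swap_mem_bases (hB : B ∈ N.bases) {x y : Sym2 S ⊕ S} (hx : x ∈ B) (hy : y ∉ B)
    (hN : ∀ e, y = Sum.inl e → e ∈ N.graph.edgeSet)
    (h : ((cone B).deleteEdges {coneEdge x} ⊔ SimpleGraph.fromEdgeSet {coneEdge y}).IsAcyclic) :
    insert y (B.erase x) ∈ N.bases := by
  refine ⟨fun e he => ?_, ?_, ?_⟩
  · rcases Finset.mem_insert.1 he with h1 | h1
    · exact hN e h1.symm
    · exact hB.1 e (Finset.mem_of_mem_erase h1)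
  · rwa [cone_insert, cone_erase]
  · rw [Finset.card_insert_of_notMem (fun h => hy (Finset.mem_of_mem_erase h)),
      Finset.card_erase_add_one hx, hB.2.2]

theorem isSymmExchange_bases (N : PotentialNetwork S) : Exchange.IsSymmExchange N.bases := by
  intro B hB C hC x hxB hxC
  have eB := edgeSet_cone (not_isDiag_of_mem_bases hB.1)
  have eC := edgeSet_cone (not_isDiag_of_mem_bases hC.1)
  obtain ⟨y, hyC, hyB, h1, h2⟩ := (isTree_cone hB).exists_exchange (isTree_cone hC)
    (x := coneEdge x) (eB ▸ Set.mem_image_of_mem _ hxB)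
    (by rw [eC, coneEdge_injective.mem_set_image]; exact hxC)
  rw [eC] at hyC
  obtain ⟨y, hyC, rfl⟩ := hyC
  rw [eB, coneEdge_injective.mem_set_image] at hyB
  exact ⟨y, hyC, hyB, swap_mem_bases hB hxB hyB (fun e he => hC.1 e (he ▸ hyC)) h1,
    swap_mem_bases hC hyC hxC (fun e he => hB.1 e (he ▸ hxB)) h2⟩

/-- The pairs in `splits` are the exchanges of an edge against a new sink. -/
theorem mem_splits_iff (hB : B ∈ N.bases) {e : Sym2 S} {i : S} :
    (e, i) ∈ splits B.toRight (forestPart B) ↔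
      Sum.inl e ∈ B ∧ Sum.inr i ∉ B ∧ insert (Sum.inr i) (B.erase (Sum.inl e)) ∈ N.bases := by
  have hedge : e ∈ (forestPart B).edgeSet ↔ Sum.inl e ∈ B := by
    rw [forestPart, SimpleGraph.edgeSet_fromEdgeSet]
    simp only [Set.mem_sdiff, SetLike.mem_coe, Finset.mem_toLeft]
    exact ⟨fun h => h.1, fun h => ⟨h, not_isDiag_of_mem_bases hB.1 e h⟩⟩
  have hreach : (∃ s ∈ B.toRight, ((forestPart B).deleteEdges {e}).Reachable s i) ↔
      (cone (B.erase (Sum.inl e))).Reachable none (some i) := by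
    rw [cone_reachable_none_iff, forestPart_erase_inl]
    simp
  constructor
  · rintro ⟨h1, -, h3⟩
    simp only at h1 h3
    have hnr : ¬ (cone (B.erase (Sum.inl e))).Reachable none (some i) := by
      rw [← hreach]; push Not; exact h3
    have hi : Sum.inr i ∉ B := fun hi => h3 i (by simpa using hi) (.refl _)
    refine ⟨hedge.1 h1, hi, swap_mem_bases hB (hedge.1 h1) hi (by simp) ?_⟩
    rw [← cone_erase]
    refine SimpleGraph.IsAcyclic.sup_edge_of_not_reachable hnr ?_
    rw [cone_erase]
    exact hB.2.1.anti (SimpleGraph.deleteEdges_le _)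
  · rintro ⟨he, hi, hC⟩
    have hnr : ¬ (cone (B.erase (Sum.inl e))).Reachable none (some i) := by
      have hadj : (cone (insert (Sum.inr i) (B.erase (Sum.inl e)))).Adj none (some i) :=
        cone_adj_none.2 (Finset.mem_insert_self _ _)
      have hbr := SimpleGraph.isBridge_iff.1
        (SimpleGraph.isAcyclic_iff_forall_adj_isBridge.1 hC.2.1 hadj)
      have h4 : coneEdge (Sum.inr i) = s(none, some i) := rfl
      rwa [← h4, ← cone_erase, Finset.erase_insert] at hbr
      simpa using hi
    have h3 := hnr
    rw [← hreach] at h3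
    push Not at h3
    refine ⟨hedge.2 he, fun p hp => ?_, h3⟩
    -- A forest walk to `i` from a sink must use `e`, since deleting `e` cuts `i` off from all
    -- sinks. Hence the ends of `e` lie in the tree of `i`.
    obtain ⟨s, hs, ⟨q⟩⟩ := exists_reachable_sink hB i
    have hmem := q.mem_edges_of_not_reachable_deleteEdges (h3 s (by simpa using hs))
    simp only at hp
    have hps := SimpleGraph.Walk.mem_support_of_mem_edges hmem hp
    exact ⟨q.dropUntil p hps⟩

end PotentialNetwork

/-! ### W-graphs as spanning trees of the cone -/

namespace PotentialNetwork

variable {S : Type*} {N : PotentialNetwork S} {W : Finset S} {g : Finset (S × S)}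

namespace IsWGraph

theorem not_loop (h : N.IsWGraph W g) {i j : S} (hij : (i, j) ∈ g) : i ≠ j :=
  (h.1 i j hij).1.ne

theorem not_reflTransGen (h : N.IsWGraph W g) {i j : S} (hij : (i, j) ∈ g) :
    ¬ Relation.ReflTransGen (fun a b : S => (a, b) ∈ g) j i :=
  fun hr => h.2.2 i (Relation.TransGen.head' hij hr)

/-- Two opposite arrows on one edge would be a directed 2-cycle. -/
theorem injOn_edge (h : N.IsWGraph W g) :
    Set.InjOn (fun a : S × S => s(a.1, a.2)) (g : Set (S × S)) := by
  rintro ⟨i, j⟩ hij ⟨k, l⟩ hkl he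
  rcases Sym2.eq_iff.1 he with ⟨h1, h2⟩ | ⟨h1, h2⟩
  · exact Prod.ext h1 h2
  · simp only at h1 h2
    subst h1 h2
    exact absurd (.single hkl) (h.not_reflTransGen hij)

theorem injOn_fst (h : N.IsWGraph W g) : Set.InjOn Prod.fst (g : Set (S × S)) := by
  rintro ⟨i, j⟩ hij ⟨k, l⟩ hkl he
  simp only at he
  subst he
  exact Prod.ext rfl ((h.2.1 i (h.1 i j hij).2).unique hij hkl)

/-- On a finite set an acyclic relation is well-founded, so following arrows ends in a sink. -/
theorem exists_sink [Finite S] (h : N.IsWGraph W g) (i : S) :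
    ∃ s ∈ W, Relation.ReflTransGen (fun a b : S => (a, b) ∈ g) i s := by
  let r : S → S → Prop := fun b a => Relation.TransGen (fun a b : S => (a, b) ∈ g) a b
  have : IsTrans S r := ⟨fun a b c hab hbc => hbc.trans hab⟩
  have : Std.Irrefl r := ⟨h.2.2⟩
  have hwf : WellFounded r := Finite.wellFounded_of_trans_of_irrefl r
  induction i using hwf.induction with
  | _ i ih =>
    by_cases hi : i ∈ W
    · exact ⟨i, hi, .refl⟩
    · obtain ⟨j, hj, -⟩ := h.2.1 i hi
      obtain ⟨s, hs, hr⟩ := ih j (.single hj)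
      exact ⟨s, hs, hr.head hj⟩

variable [DecidableEq S]

theorem image_fst [Fintype S] (h : N.IsWGraph W g) : g.image Prod.fst = Wᶜ := by
  ext i
  simp only [Finset.mem_image, Prod.exists, exists_and_right, exists_eq_right, Finset.mem_compl]
  exact ⟨fun ⟨j, hj⟩ => (h.1 i j hj).2, fun hi => (h.2.1 i hi).exists⟩

/-- Turning one more state into a sink. -/
theorem insert_sink (h : N.IsWGraph W g) (i : S) :
    N.IsWGraph (insert i W) (g.filter fun a => a.1 ≠ i) := by
  refine ⟨fun a b hab => ?_, fun a ha => ?_, fun a ha => ?_⟩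
  · rw [Finset.mem_filter] at hab
    have := h.1 a b hab.1
    exact ⟨this.1, by simpa using ⟨hab.2, this.2⟩⟩
  · rw [Finset.mem_insert, not_or] at ha
    simpa [ha.1] using h.2.1 a ha.2
  · exact h.2.2 a (ha.lift id fun x y hxy => (Finset.mem_filter.1 hxy).1)

end IsWGraph

variable [DecidableEq S]

/-- The edges and the sinks of a `W`-graph. -/
def baseOf (W : Finset S) (g : Finset (S × S)) : Finset (Sym2 S ⊕ S) :=
  (g.image fun a => s(a.1, a.2)).disjSum W

theorem inl_mem_baseOf {i j : S} :
    Sum.inl s(i, j) ∈ baseOf W g ↔ (i, j) ∈ g ∨ (j, i) ∈ g := by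
  simp only [baseOf, Finset.inl_mem_disjSum, Finset.mem_image, Prod.exists, Sym2.eq_iff]
  constructor
  · rintro ⟨a, b, hab, ⟨rfl, rfl⟩ | ⟨rfl, rfl⟩⟩
    · exact Or.inl hab
    · exact Or.inr hab
  · rintro (h | h)
    · exact ⟨i, j, h, by simp⟩
    · exact ⟨j, i, h, by simp⟩

theorem inr_mem_baseOf {i : S} : Sum.inr i ∈ baseOf W g ↔ i ∈ W := by
  simp [baseOf]

theorem toRight_baseOf : (baseOf W g).toRight = W := by simp [baseOf]

theorem forestPart_baseOf : forestPart (baseOf W g) = forest g := by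
  ext i j
  rw [forestPart_adj, inl_mem_baseOf, forest, SimpleGraph.fromRel_adj, and_comm]

variable [Fintype S]

theorem IsWGraph.card_baseOf (h : N.IsWGraph W g) : (baseOf W g).card = Fintype.card S := by
  rw [baseOf, Finset.card_disjSum, Finset.card_image_of_injOn h.injOn_edge,
    ← Finset.card_image_of_injOn h.injOn_fst, h.image_fst, Finset.card_compl_add_card]

theorem IsWGraph.baseOf_mem_bases (h : N.IsWGraph W g) : baseOf W g ∈ N.bases := by
  refine mem_bases_of_reachable (fun e he => ?_) h.card_baseOf fun j => ?_
  · induction e with | _ a b =>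
    rcases inl_mem_baseOf.1 he with h1 | h1
    · exact (h.1 a b h1).1
    · exact (h.1 b a h1).1.symm
  · obtain ⟨s, hs, hr⟩ := h.exists_sink j
    refine ⟨s, inr_mem_baseOf.2 hs, SimpleGraph.Reachable.symm ?_⟩
    rw [SimpleGraph.reachable_iff_reflTransGen]
    refine hr.lift id fun a b hab => ?_
    exact forestPart_adj.2 ⟨inl_mem_baseOf.2 (Or.inl hab), h.not_loop hab⟩

/-- The head of an arrow stays connected to the apex of the cone without that arrow. -/
theorem IsWGraph.reachable_none_of_arrow (h : N.IsWGraph W g) {i j : S} (hij : (i, j) ∈ g) :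
    ((cone (baseOf W g)).deleteEdges {s(some i, some j)}).Reachable (some j) none := by
  obtain ⟨s, hs, hr⟩ := h.exists_sink j
  have key : ∀ a, Relation.ReflTransGen (fun a b : S => (a, b) ∈ g) j a →
      ((cone (baseOf W g)).deleteEdges {s(some i, some j)}).Reachable (some j) (some a) := by
    intro a ha
    induction ha with
    | refl => exact .refl _
    | @tail b c hjb hbc ih =>
      refine ih.trans (SimpleGraph.Adj.reachable ?_)
      rw [SimpleGraph.deleteEdges_adj, cone_adj_some, forestPart_adj]
      refine ⟨⟨inl_mem_baseOf.2 (Or.inl hbc), h.not_loop hbc⟩, fun he => ?_⟩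
      simp only [Set.mem_singleton_iff, Sym2.eq_iff, Option.some.injEq] at he
      rcases he with ⟨rfl, -⟩ | ⟨-, rfl⟩
      · exact h.not_reflTransGen hij hjb
      · exact h.not_reflTransGen hij (hjb.tail hbc)
  refine (key s hr).trans (SimpleGraph.Adj.reachable ?_)
  rw [SimpleGraph.deleteEdges_adj]
  exact ⟨(cone_adj_none.2 (inr_mem_baseOf.2 hs)).symm, by simp⟩

/-- If two `W`-graphs with the same tree oriented an edge oppositely, each end would be the head of
an arrow and so reach the apex without that edge, which is nevertheless a bridge. -/
theorem baseOf_injOn {W' : Finset S} {g' : Finset (S × S)} (h : N.IsWGraph W g)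
    (h' : N.IsWGraph W' g') (he : baseOf W g = baseOf W' g') : W = W' ∧ g = g' := by
  have key : ∀ {W W' : Finset S} {g g' : Finset (S × S)}, N.IsWGraph W g → N.IsWGraph W' g' →
      baseOf W g = baseOf W' g' → g ⊆ g' := by
    rintro W W' g g' h h' he ⟨i, j⟩ hij
    rcases inl_mem_baseOf.1 (he ▸ inl_mem_baseOf.2 (Or.inl hij) :
      Sum.inl s(i, j) ∈ baseOf W' g') with h1 | h1
    · exact h1
    · have hadj : (cone (baseOf W g)).Adj (some i) (some j) := by
        rw [cone_adj_some, forestPart_adj]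
        exact ⟨inl_mem_baseOf.2 (Or.inl hij), h.not_loop hij⟩
      have hbr := SimpleGraph.isBridge_iff.1
        (SimpleGraph.isAcyclic_iff_forall_adj_isBridge.1 h.baseOf_mem_bases.2.1 hadj)
      have r1 := h.reachable_none_of_arrow hij
      have r2 := h'.reachable_none_of_arrow h1
      rw [← he, Sym2.eq_swap] at r2
      exact absurd (r2.trans r1.symm) hbr
  refine ⟨?_, (key h h' he).antisymm (key h' h he.symm)⟩
  rw [← toRight_baseOf (W := W) (g := g), he, toRight_baseOf]

/-- Each non-sink points to its neighbour one step closer to the apex. Distance falls along arrows,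
which excludes cycles. -/
theorem exists_isWGraph_of_mem_bases {B : Finset (Sym2 S ⊕ S)} (hB : B ∈ N.bases) :
    ∃ W g, N.IsWGraph W g ∧ baseOf W g = B := by
  have hT := isTree_cone hB
  have hpar : ∀ i : S, ∃ j : S, i ∉ B.toRight →
      (forestPart B).Adj i j ∧ (cone B).dist none (some j) < (cone B).dist none (some i) := by
    intro i
    by_cases hi : i ∈ B.toRight
    -- At a sink the parent is a dummy value, never used as the head of an arrow.
    · exact ⟨i, fun h => absurd hi h⟩
    obtain ⟨p, hp⟩ := hT.connected.exists_walk_length_eq_dist (some i) none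
    cases p with
    | @cons _ v _ hadj q =>
      cases v with
      | none => exact absurd (Finset.mem_toRight.2 (cone_adj_none.1 hadj.symm)) hi
      | some j =>
        refine ⟨j, fun _ => ⟨cone_adj_some.1 hadj, ?_⟩⟩
        have h1 := SimpleGraph.dist_le q
        rw [SimpleGraph.Walk.length_cons] at hp
        rw [SimpleGraph.dist_comm, SimpleGraph.dist_comm (u := none)]
        omega
  choose par hadj hdist using hpar
  have hmem : ∀ i j, (i, j) ∈ (B.toRightᶜ).image (fun i => (i, par i)) ↔
      i ∉ B.toRight ∧ par i = j := by
    intro i j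
    simp only [Finset.mem_image, Finset.mem_compl, Prod.mk.injEq]
    constructor
    · rintro ⟨a, ha, rfl, rfl⟩
      exact ⟨ha, rfl⟩
    · rintro ⟨hi, rfl⟩
      exact ⟨i, hi, rfl, rfl⟩
  have hW : N.IsWGraph B.toRight ((B.toRightᶜ).image fun i => (i, par i)) := by
    refine ⟨fun i j hij => ?_, fun i hi => ?_, fun i hi => ?_⟩
    · obtain ⟨hi, rfl⟩ := (hmem i j).1 hij
      exact ⟨hB.1 _ (forestPart_adj.1 (hadj i hi)).1, hi⟩
    · exact ⟨par i, (hmem _ _).2 ⟨hi, rfl⟩, fun j hj => ((hmem _ _).1 hj).2.symm⟩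
    · have key : ∀ a, Relation.TransGen
          (fun a b : S => (a, b) ∈ (B.toRightᶜ).image fun i => (i, par i)) i a →
          (cone B).dist none (some a) < (cone B).dist none (some i) := by
        intro a ha
        induction ha with
        | single h =>
          obtain ⟨h1, rfl⟩ := (hmem _ _).1 h
          exact hdist _ h1
        | tail _ h ih =>
          obtain ⟨h1, rfl⟩ := (hmem _ _).1 h
          exact (hdist _ h1).trans ih
      exact lt_irrefl _ (key i hi)
  -- All arrows run along edges of `B`, so inclusion and equal cardinality suffice.
  refine ⟨_, _, hW, Finset.eq_of_subset_of_card_le ?_ (by rw [hW.card_baseOf, hB.2.2])⟩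
  rintro (e | i) hx
  · induction e with | _ i j =>
    rcases inl_mem_baseOf.1 hx with h | h
    · obtain ⟨hi, rfl⟩ := (hmem _ _).1 h
      exact (forestPart_adj.1 (hadj i hi)).1
    · obtain ⟨hj, rfl⟩ := (hmem _ _).1 h
      exact (forestPart_adj.1 (hadj j hj).symm).1
  · exact Finset.mem_toRight.1 (inr_mem_baseOf.1 hx)

/-- The potentials of edges and states as weights of the elements of `bases`. -/
def weight (N : PotentialNetwork S) : Sym2 S ⊕ S → ℝ := Sum.elim N.saddle N.V

/-- The arrows start exactly once at each state outside `W`, so subtracting `V` at their origins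
amounts to adding `V` over the sinks and subtracting its total. -/
theorem IsWGraph.cost_eq (h : N.IsWGraph W g) :
    N.cost g = ∑ a ∈ baseOf W g, N.weight a - ∑ i, N.V i := by
  have h1 : ∑ a ∈ g, N.V a.1 = ∑ i ∈ Wᶜ, N.V i := by
    rw [← h.image_fst, Finset.sum_image h.injOn_fst]
  have h2 := Finset.sum_compl_add_sum W N.V
  have h3 : ∑ a ∈ g, N.saddle s(a.1, a.2) = ∑ e ∈ g.image (fun a => s(a.1, a.2)), N.saddle e := by
    rw [Finset.sum_image h.injOn_edge]
  rw [cost, Finset.sum_sub_distrib, baseOf, Finset.sum_disjSum, h1, h3]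
  simp only [weight, Sum.elim_inl, Sum.elim_inr]
  linarith

omit [DecidableEq S] [Fintype S] in
theorem level_eq (B : Finset (Sym2 S ⊕ S)) :
    Exchange.level (fun a => a.isRight = true) B = B.toRight.card := by
  have : B.filter (fun a => a.isRight = true) = B.toRight.map Function.Embedding.inr := by
    ext (e | i) <;> simp
  rw [Exchange.level, this, Finset.card_map]

theorem isOptimal_iff {k : ℕ} : N.IsOptimal k W g ↔ N.IsWGraph W g ∧
    Exchange.IsOpt N.bases (fun a => a.isRight = true) N.weight k (baseOf W g) := by
  constructor
  · rintro ⟨hk, h, hmin⟩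
    refine ⟨h, h.baseOf_mem_bases, by rw [level_eq, toRight_baseOf, hk], fun C hC hl => ?_⟩
    obtain ⟨W', g', h', rfl⟩ := exists_isWGraph_of_mem_bases hC
    rw [level_eq, toRight_baseOf] at hl
    have := hmin W' g' hl h'
    rw [h.cost_eq, h'.cost_eq] at this
    linarith
  · rintro ⟨h, -, hl, hmin⟩
    rw [level_eq, toRight_baseOf] at hl
    refine ⟨hl, h, fun W' g' hk h' => ?_⟩
    have := hmin _ h'.baseOf_mem_bases (by rw [level_eq, toRight_baseOf, hk])
    rw [h.cost_eq, h'.cost_eq]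
    linarith

omit [DecidableEq S] in
theorem Generic.isGenericWeight (hN : N.Generic) :
    Exchange.IsGenericWeight N.bases (fun a => a.isRight = true) N.weight := by
  obtain ⟨hV, hE, -, hd⟩ := hN
  constructor
  · rintro B hB C hC (e | i) hx (f | j) hy hc he
    · exact congrArg _ (hE e (hB.1 e hx) f (hC.1 f hy) he)
    · simp at hc
    · simp at hc
    · exact congrArg _ (hV i j he)
  · rintro B hB C hC (e | _) hx (e' | _) hx' (_ | i) hy (_ | i') hy' h1 h2 h3 h4 he
    all_goals simp only [Sum.isRight_inl, Sum.isRight_inr, not_true, reduceCtorEq] at h1 h2 h3 h4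
    obtain ⟨rfl, rfl⟩ := hd e (hB.1 e hx) e' (hB.1 e' hx') i i' he
    exact ⟨rfl, rfl⟩

omit [DecidableEq S] in
theorem card_eq_of_mem_bases (B : Finset (Sym2 S ⊕ S)) (hB : B ∈ N.bases)
    (C : Finset (Sym2 S ⊕ S)) (hC : C ∈ N.bases) : B.card = C.card :=
  hB.2.2.trans hC.2.2.symm

omit [DecidableEq S] in
open Classical in
/-- A spanning tree together with a single sink. -/
theorem disjSum_singleton_mem_bases {T : SimpleGraph S} (hT : T.IsTree) (hle : T ≤ N.graph)
    (r : S) : T.edgeFinset.disjSum {r} ∈ N.bases := by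
  refine mem_bases_of_reachable (fun e he => ?_) ?_ fun j => ⟨r, by simp, ?_⟩
  · exact SimpleGraph.edgeSet_mono hle (by simpa using he)
  · rw [Finset.card_disjSum, Finset.card_singleton, hT.card_edgeFinset]
  · have : forestPart (T.edgeFinset.disjSum {r}) = T := by
      simp [forestPart, SimpleGraph.fromEdgeSet_edgeSet]
    rw [this]
    exact hT.connected r j

/-- Nonemptiness of the set being minimized: root a spanning tree, then turn states into sinks one
at a time. -/
theorem exists_isWGraph (N : PotentialNetwork S) {k : ℕ} (hk : 1 ≤ k) (hn : k ≤ Fintype.card S) :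
    ∃ W g, W.card = k ∧ N.IsWGraph W g := by
  induction k, hk using Nat.le_induction with
  | base =>
    obtain ⟨T, hle, hT⟩ := N.connected.exists_isTree_le
    obtain ⟨r⟩ := N.connected.nonempty
    obtain ⟨W, g, h, he⟩ := exists_isWGraph_of_mem_bases (disjSum_singleton_mem_bases hT hle r)
    refine ⟨W, g, ?_, h⟩
    rw [← toRight_baseOf (W := W) (g := g), he, Finset.toRight_disjSum, Finset.card_singleton]
  | succ k _ ih =>
    obtain ⟨W, g, hW, h⟩ := ih (by omega)
    obtain ⟨i, hi⟩ : ∃ i, i ∉ W := by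
      by_contra! hall
      rw [Finset.eq_univ_iff_forall.2 hall, Finset.card_univ] at hW
      omega
    exact ⟨_, _, by rw [Finset.card_insert_of_notMem hi, hW], h.insert_sink i⟩

theorem exists_isOptimal (N : PotentialNetwork S) {k : ℕ} (hk : 1 ≤ k)
    (hn : k ≤ Fintype.card S) : ∃ W g, N.IsOptimal k W g := by
  obtain ⟨W, g, hW, h⟩ := N.exists_isWGraph hk hn
  obtain ⟨C, hC⟩ := Exchange.exists_isOpt (w := N.weight) (red := fun a => a.isRight = true)
    h.baseOf_mem_bases (k := k) (by rw [level_eq, toRight_baseOf, hW])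
  obtain ⟨W', g', h', rfl⟩ := exists_isWGraph_of_mem_bases hC.1
  exact ⟨W', g', isOptimal_iff.2 ⟨h', hC⟩⟩

omit [DecidableEq S] [Fintype S] in
theorem IsOptimal.isLeast {k : ℕ} (h : N.IsOptimal k W g) : IsLeast (N.costs k) (N.cost g) := by
  refine ⟨⟨W, g, h.1, h.2.1, rfl⟩, ?_⟩
  rintro _ ⟨W', g', hk, h', rfl⟩
  exact h.2.2 W' g' hk h'

omit [DecidableEq S] [Fintype S] in
theorem IsOptimal.Vmin_eq {k : ℕ} (h : N.IsOptimal k W g) : N.Vmin k = N.cost g :=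
  h.isLeast.csInf_eq

theorem IsOptimal.unique (hN : N.Generic) {k : ℕ} {W' : Finset S} {g' : Finset (S × S)}
    (h : N.IsOptimal k W g) (h' : N.IsOptimal k W' g') : W = W' ∧ g = g' := by
  rw [isOptimal_iff] at h h'
  exact baseOf_injOn h.1 h'.1 (Exchange.isOpt_unique N.isSymmExchange_bases hN.isGenericWeight
    card_eq_of_mem_bases h.2 h'.2)

/-- An optimal `W`-graph with one more sink arises by exchanging an edge against a new sink. -/
theorem IsOptimal.succ (hN : N.Generic) {k : ℕ} {W' : Finset S} {g' : Finset (S × S)}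
    (h : N.IsOptimal k W g) (h' : N.IsOptimal (k + 1) W' g') :
    ∃ e i, (e, i) ∈ splits W (forest g) ∧ i ∉ W ∧
      baseOf W' g' = insert (Sum.inr i) ((baseOf W g).erase (Sum.inl e)) := by
  rw [isOptimal_iff] at h h'
  obtain ⟨x, hx, y, hy, hxr, hyr, heq⟩ := Exchange.isOpt_succ N.isSymmExchange_bases
    hN.isGenericWeight card_eq_of_mem_bases h.2 h'.2
  obtain e | _ := x
  swap
  · simp at hxr
  obtain _ | i := y
  · simp at hyr
  refine ⟨e, i, ?_, fun hi => hy (inr_mem_baseOf.2 hi), heq⟩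
  have := (mem_splits_iff h.2.1 (e := e) (i := i)).2 ⟨hx, hy, heq ▸ h'.2.1⟩
  rwa [toRight_baseOf, forestPart_baseOf] at this

/-- Every split is an exchange producing a competitor with `k + 1` sinks; this gives the upper bound
on gains. -/
theorem IsOptimal.cost_succ_le {k : ℕ} {W' : Finset S} {g' : Finset (S × S)}
    (h : N.IsOptimal k W g) (h' : N.IsOptimal (k + 1) W' g') {x : Sym2 S × S}
    (hx : x ∈ splits W (forest g)) : N.cost g' ≤ N.cost g - N.gain x := by
  obtain ⟨e, i⟩ := x
  rw [isOptimal_iff] at h h'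
  rw [← toRight_baseOf (W := W) (g := g), ← forestPart_baseOf (W := W)] at hx
  obtain ⟨he, hi, hC⟩ := (mem_splits_iff h.2.1).1 hx
  have l := Exchange.level_swap (red := fun a : Sym2 S ⊕ S => a.isRight = true) he hi
  have s := Exchange.sum_swap he hi N.weight
  have hl : Exchange.level (fun a : Sym2 S ⊕ S => a.isRight = true) (baseOf W g) = k := h.2.2.1
  simp only [hl, Sum.isRight_inl, Sum.isRight_inr, if_true, Bool.false_eq_true, if_false] at l
  have := h'.2.2.2 _ hC (by omega)
  rw [h.1.cost_eq, h'.1.cost_eq]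
  simp only [weight, gain, Sum.elim_inl, Sum.elim_inr] at s this ⊢
  linarith

end PotentialNetwork

/-! ### The minimum spanning tree and the recurrence. -/

namespace PotentialNetwork

variable {S : Type*} [Fintype S] [DecidableEq S] {N : PotentialNetwork S} {W : Finset S}
  {g : Finset (S × S)}

open Classical in
theorem IsWGraph.baseOf_eq (h : N.IsWGraph W g) :
    baseOf W g = (forest g).edgeFinset.disjSum W := by
  ext (e | i)
  · induction e with | _ i j =>
    rw [inl_mem_baseOf, Finset.inl_mem_disjSum, SimpleGraph.mem_edgeFinset,
      SimpleGraph.mem_edgeSet, forest, SimpleGraph.fromRel_adj, iff_and_self]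
    rintro (h1 | h1)
    · exact h.not_loop h1
    · exact (h.not_loop h1).symm
  · simp [inr_mem_baseOf]

open Classical in
omit [DecidableEq S] in
theorem sum_weight_disjSum_singleton (N : PotentialNetwork S) (T : SimpleGraph S) (r : S) :
    ∑ a ∈ T.edgeFinset.disjSum {r}, N.weight a = N.edgeSum T + N.V r := by
  rw [Finset.sum_disjSum, Finset.sum_singleton]
  rfl

omit [Fintype S] [DecidableEq S] in
theorem IsWGraph.forest_le (h : N.IsWGraph W g) : forest g ≤ N.graph := by
  intro i j hij
  rw [forest, SimpleGraph.fromRel_adj] at hij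
  rcases hij.2 with h1 | h1
  · exact (h.1 i j h1).1
  · exact (h.1 j i h1).1.symm

open Classical in
theorem IsWGraph.isTree_forest {r : S} (h : N.IsWGraph {r} g) : (forest g).IsTree := by
  have hr : ∀ j, (forest g).Reachable r j := by
    intro j
    obtain ⟨s, hs, hr⟩ := exists_reachable_sink h.baseOf_mem_bases j
    rw [inr_mem_baseOf, Finset.mem_singleton] at hs
    rwa [hs, forestPart_baseOf] at hr
  have : Nonempty S := ⟨r⟩
  refine SimpleGraph.isTree_iff_connected_and_card.2 ⟨⟨fun u v => (hr u).symm.trans (hr v)⟩, ?_⟩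
  have hc := h.card_baseOf
  rw [h.baseOf_eq, Finset.card_disjSum, Finset.card_singleton] at hc
  rw [Nat.card_eq_fintype_card, Nat.card_eq_fintype_card, ← SimpleGraph.edgeFinset_card, hc]

open Classical in
/-- The optimal `W`-graph with one sink is the minimum spanning tree, rooted at the minimum of the
potential. -/
theorem exists_isMinSpanningTree (hN : N.Generic) :
    ∃ T : SimpleGraph S, N.IsMinSpanningTree T ∧
      (∀ T' : SimpleGraph S, N.IsMinSpanningTree T' → T' = T) ∧
      N.Vmin 1 = N.edgeSum T + (⨅ i : S, N.V i) - ∑ i : S, N.V i := by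
  have hne := N.connected.nonempty
  obtain ⟨W, g, hopt⟩ := N.exists_isOptimal le_rfl (Fintype.card_pos (α := S))
  obtain ⟨r, rfl⟩ := Finset.card_eq_one.1 hopt.1
  have hg := hopt.2.1
  have hT := hg.isTree_forest
  have hsum : ∑ a ∈ baseOf {r} g, N.weight a = N.edgeSum (forest g) + N.V r := by
    rw [hg.baseOf_eq, sum_weight_disjSum_singleton]
  have hO := (isOptimal_iff.1 hopt).2
  have hlevel : ∀ (T : SimpleGraph S) (i : S), Exchange.level
      (fun a : Sym2 S ⊕ S => a.isRight = true) (T.edgeFinset.disjSum {i}) = 1 := by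
    intro T i
    rw [level_eq, Finset.toRight_disjSum, Finset.card_singleton]
  -- Tree and root vary independently: fixing the root `r` shows the tree is minimal, fixing the
  -- tree shows `V r` is minimal.
  have hmin : ∀ (T : SimpleGraph S) (i : S), T ≤ N.graph → T.IsTree →
      N.edgeSum (forest g) + N.V r ≤ N.edgeSum T + N.V i := by
    intro T i hle hT
    have := hO.2.2 _ (disjSum_singleton_mem_bases hT hle i) (hlevel T i)
    rwa [hsum, sum_weight_disjSum_singleton] at this
  have hMST : N.IsMinSpanningTree (forest g) :=
    ⟨hg.forest_le, hT, fun T' hle hT' => by linarith [hmin T' r hle hT']⟩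
  refine ⟨forest g, hMST, fun T' hT' => ?_, ?_⟩
  · have h1 := hT'.2.2 _ hMST.1 hMST.2.1
    have hO' : Exchange.IsOpt N.bases (fun a => a.isRight = true) N.weight 1
        (T'.edgeFinset.disjSum {r}) := by
      refine ⟨disjSum_singleton_mem_bases hT'.2.1 hT'.1 r, hlevel T' r, fun C hC hl => ?_⟩
      have := hO.2.2 C hC hl
      rw [sum_weight_disjSum_singleton]
      linarith
    have he := Exchange.isOpt_unique N.isSymmExchange_bases hN.isGenericWeight
      card_eq_of_mem_bases hO' hO
    rw [hg.baseOf_eq] at he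
    have := congrArg Finset.toLeft he
    rw [Finset.toLeft_disjSum, Finset.toLeft_disjSum] at this
    exact SimpleGraph.edgeFinset_inj.1 this
  · have hinf : (⨅ i : S, N.V i) = N.V r :=
      le_antisymm (ciInf_le (Set.finite_range _).bddBelow r)
        (le_ciInf fun i => by linarith [hmin _ i hMST.1 hT])
    rw [hopt.Vmin_eq, hg.cost_eq, hsum, hinf]

/-- The step from `k` to `k + 1` sinks. -/
theorem IsOptimal.step (hN : N.Generic) {k : ℕ} {W' : Finset S} {g' : Finset (S × S)}
    (h : N.IsOptimal k W g) (h' : N.IsOptimal (k + 1) W' g') :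
    ∃ (e : Sym2 S) (i : S), (e, i) ∈ splits W (forest g) ∧ i ∉ W ∧ W' = insert i W ∧
      forest g' = (forest g).deleteEdges {e} ∧ N.cost g' = N.cost g - N.gain (e, i) := by
  obtain ⟨e, i, hs, hi, heq⟩ := h.succ hN h'
  have he : Sum.inl e ∈ baseOf W g := by
    have := hs
    rw [← toRight_baseOf (W := W) (g := g), ← forestPart_baseOf (W := W),
      mem_splits_iff h.2.1.baseOf_mem_bases] at this
    exact this.1
  refine ⟨e, i, hs, hi, ?_, ?_, ?_⟩
  · rw [← toRight_baseOf (W := W') (g := g'), heq]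
    ext a
    simp [inr_mem_baseOf]
  · rw [← forestPart_baseOf (W := W'), heq, ← forestPart_baseOf (W := W), ← forestPart_erase_inl,
      forestPart, forestPart]
    congr 1
    ext f
    simp
  · have s := Exchange.sum_swap he (fun hb => hi (inr_mem_baseOf.1 hb)) N.weight
    rw [← heq] at s
    rw [h.2.1.cost_eq, h'.2.1.cost_eq]
    simp only [weight, gain, Sum.elim_inl, Sum.elim_inr] at s ⊢
    linarith

end PotentialNetwork

theorem theorem3p4 {S : Type*} [Fintype S] [DecidableEq S] (N : PotentialNetwork S)
    (hN : N.Generic) :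
    -- for every `k` the minimum defining `V^{(k)}` is attained, at exactly one `W`-graph
    (∀ k : ℕ, 1 ≤ k → k ≤ Fintype.card S →
      IsLeast (N.costs k) (N.Vmin k) ∧
      ∃! Wg : Finset S × Finset (S × S), N.IsOptimal k Wg.1 Wg.2) ∧
    -- the optimal `W`-graphs are nested
    (∀ k : ℕ, 1 ≤ k → k < Fintype.card S →
      ∀ (W W' : Finset S) (g g' : Finset (S × S)),
        N.IsOptimal k W g → N.IsOptimal (k + 1) W' g' →
          W ⊂ W' ∧ PotentialNetwork.forest g' < PotentialNetwork.forest g) ∧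
    -- the initial value of the recurrence
    (∃ T : SimpleGraph S, N.IsMinSpanningTree T ∧
      (∀ T' : SimpleGraph S, N.IsMinSpanningTree T' → T' = T) ∧
      N.Vmin 1 = N.edgeSum T + (⨅ i : S, N.V i) - ∑ i : S, N.V i) ∧
    -- the recurrence, the unique optimal edge `e` and new sink `i`, and the value of `Δ_k`
    (∀ k : ℕ, 1 ≤ k → k < Fintype.card S →
      ∀ (W W' : Finset S) (g g' : Finset (S × S)),
        N.IsOptimal k W g → N.IsOptimal (k + 1) W' g' →
          ∃ m : ℝ,
            IsGreatest (N.gain '' PotentialNetwork.splits W (PotentialNetwork.forest g)) m ∧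
            N.Vmin (k + 1) = N.Vmin k - m ∧
            ∃ (e : Sym2 S) (i : S),
              (e, i) ∈ PotentialNetwork.splits W (PotentialNetwork.forest g) ∧
              N.gain (e, i) = m ∧
              (∀ x ∈ PotentialNetwork.splits W (PotentialNetwork.forest g),
                N.gain x = m → x = (e, i)) ∧
              PotentialNetwork.forest g' = (PotentialNetwork.forest g).deleteEdges {e} ∧
              i ∉ W ∧ W' = insert i W ∧
              N.Delta k = N.saddle e - N.V i) := by
  refine ⟨fun k hk hn => ?_, fun k _ _ W W' g g' h h' => ?_, PotentialNetwork.exists_isMinSpanningTree hN,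
    fun k _ _ W W' g g' h h' => ?_⟩
  · obtain ⟨W, g, h⟩ := N.exists_isOptimal hk hn
    refine ⟨h.Vmin_eq ▸ h.isLeast, (W, g), h, ?_⟩
    rintro ⟨W', g'⟩ h'
    obtain ⟨h1, h2⟩ := h'.unique hN h
    exact Prod.ext h1 h2
  · obtain ⟨e, i, hs, hi, rfl, hf, -⟩ := h.step hN h'
    refine ⟨Finset.ssubset_insert hi, lt_of_le_of_ne ?_ fun heq => ?_⟩
    · rw [hf]
      exact SimpleGraph.deleteEdges_le _
    · have he : e ∈ (PotentialNetwork.forest g).edgeSet := hs.1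
      rw [← heq, hf, SimpleGraph.edgeSet_deleteEdges] at he
      exact he.2 rfl
  · obtain ⟨e, i, hs, hi, rfl, hf, hc⟩ := h.step hN h'
    refine ⟨N.gain (e, i), ⟨⟨_, hs, rfl⟩, ?_⟩, by rw [h.Vmin_eq, h'.Vmin_eq, hc], e, i, hs, rfl,
      fun x hx hg => ?_, hf, hi, rfl, ?_⟩
    · rintro _ ⟨x, hx, rfl⟩
      linarith [h.cost_succ_le h' hx]
    -- Equal gains force equal pairs, because the differences `V_{ij} - V_k` are distinct.
    · have hle := h.2.1.forest_le
      obtain ⟨h1, h2⟩ := hN.2.2.2 x.1 (SimpleGraph.edgeSet_mono hle hx.1) e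
        (SimpleGraph.edgeSet_mono hle hs.1) x.2 i hg
      exact Prod.ext h1 h2
    · rw [PotentialNetwork.Delta, h.Vmin_eq, h'.Vmin_eq, hc]
      simp [PotentialNetwork.gain]
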